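/- Let $M$ be a matroid of rank $r$ on a finite ground set $E$. A symmetric exchange replaces a pair of bases $(A,B)$ by the pair $\bigl((A\cup\{b\})\setminus\{a\},\,(B\cup\{a\})\setminus\{b\}\bigr)$, where $a\in A\setminus B$, $b\in B\setminus A$, and both new sets are again bases of $M$. Suppose that $M$ is paving, that is, every circuit of $M$ has size $r$ or $r+1$. Then White's conjecture holds for $M$: for every $n\ge 0$ and any two ordered $n$-tuples $(B_1,\dots,B_n)$ and $(B_1',\dots,B_n')$ of bases of $M$ with equal multiset union (every $e\in E$ lies in as many of the $B_i$ as of the $B_i'$), there is a finite sequence of $n$-tuples of bases of $M$ which starts at $(B_1,\dots,B_n)$, ends at $(B_1',\dots,B_n')$, and in which each tuple arises from the preceding one by a symmetric exchange between the bases at two distinct positions, the other bases remaining the same. Consequently, if $r\ge 1$, then for every field $\mathbb K$ the toric ideal $I_M$ of $M$, that is, the kernel of the $\mathbb K$-algebra homomorphism $\mathbb K[y_B : B \text{ a basis of } M]\to\mathbb K[x_e : e\in E]$, $y_B\mapsto\prod_{e\in B}x_e$, is generated by the binomials $y_Ay_B-y_{A'}y_{B'}$, where $A,B$ are bases of $M$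 and $(A',B')$ is obtained from $(A,B)$ by a symmetric exchange. -/

import Mathlib

namespace Matroid

universe u v

/-- A matroid of rank `r` is paving if each of its circuits has size `r` or `r + 1`. -/
def IsPaving {α : Type u} (M : Matroid α) : Prop :=
  ∀ C : Set α, M.IsCircuit C → C.encard = M.eRank ∨ C.encard = M.eRank + 1

/-- The type of bases of `M`. -/
abbrev BaseOf {α : Type u} (M : Matroid α) : Type u := {B : Set α // M.IsBase B}

/-- The pair of bases `(A', B')` is obtained from the pair of bases `(A, B)` by a symmetric
exchange: `A' = (A ∪ {b}) \ {a}` and `B' = (B ∪ {a}) \ {b}` for some `a ∈ A \ B`, `b ∈ B \ A`. -/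
def IsSymmExchange {α : Type u} (M : Matroid α) (A B A' B' : M.BaseOf) : Prop :=
  ∃ a ∈ A.1 \ B.1, ∃ b ∈ B.1 \ A.1,
    A'.1 = (A.1 ∪ {b}) \ {a} ∧ B'.1 = (B.1 ∪ {a}) \ {b}

/-- One step of an exchange sequence: the bases at two distinct positions `i`, `j` undergo a
symmetric exchange, and the other bases remain the same. -/
def ExchangeStep {α : Type u} (M : Matroid α) {n : ℕ} (S T : Fin n → M.BaseOf) : Prop :=
  ∃ i j : Fin n, i ≠ j ∧ M.IsSymmExchange (S i) (S j) (T i) (T j) ∧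
    ∀ k : Fin n, k ≠ i → k ≠ j → T k = S k

/-- The multiset union of a tuple of bases, as the function that gives the multiplicity of each
element. -/
noncomputable def multisetUnion {α : Type u} (M : Matroid α) {n : ℕ} (S : Fin n → M.BaseOf) :
    α → ℕ :=
  fun e => {i : Fin n | e ∈ (S i).1}.ncard

/-- White's conjecture in degree `n`: two `n`-tuples of bases with equal multiset union are
connected by a finite (possibly empty) sequence of exchange steps through tuples of bases. -/
def WhiteInDegree {α : Type u} (M : Matroid α) (n : ℕ) : Prop :=
  ∀ S T : Fin n → M.BaseOf, M.multisetUnion S = M.multisetUnion T →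
    Relation.ReflTransGen M.ExchangeStep S T

/-- The `K`-algebra map `K[y_B : B a base of M] → K[x_e : e ∈ E]`, `y_B ↦ ∏_{e ∈ B} x_e`. It is
meant for matroids with finite bases, for which the product is an honest finite product. -/
noncomputable def toricMap {α : Type u} (M : Matroid α) (K : Type v) [Field K] :
    MvPolynomial M.BaseOf K →ₐ[K] MvPolynomial M.E K :=
  MvPolynomial.aeval fun B : M.BaseOf =>
    ∏ᶠ (e : M.E) (_ : (e : α) ∈ B.1), (MvPolynomial.X e : MvPolynomial M.E K)

/-- The toric ideal of `M` over `K`. -/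
noncomputable def toricIdeal {α : Type u} (M : Matroid α) (K : Type v) [Field K] :
    Ideal (MvPolynomial M.BaseOf K) :=
  RingHom.ker (M.toricMap K)

/-- The symmetric-exchange binomials `y_A y_B - y_{A'} y_{B'}`. -/
def exchangeBinomials {α : Type u} (M : Matroid α) (K : Type v) [Field K] :
    Set (MvPolynomial M.BaseOf K) :=
  {p | ∃ A B A' B' : M.BaseOf, M.IsSymmExchange A B A' B' ∧
    p = MvPolynomial.X A * MvPolynomial.X B - MvPolynomial.X A' * MvPolynomial.X B'}

end Matroid

universe u v

open Finset in
theorem Finset.card_insert_erase {α : Type*} [DecidableEq α] {A : Finset α} {a b : α} (ha : a ∈ A)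
    (hb : b ∉ A) : (insert b (A.erase a)).card = A.card := by
  rw [card_insert_of_notMem (by simp [hb]), card_erase_of_mem ha]
  have := card_pos.2 ⟨a, ha⟩
  omega

@[to_additive]
theorem Finset.prod_eq_of_pair {ι N : Type*} [DecidableEq ι] [CommMonoid N] {f g : ι → N}
    {s : Finset ι} {i j : ι} (hi : i ∈ s) (hj : j ∈ s) (hij : i ≠ j) (h : g i * g j = f i * f j)
    (hk : ∀ k, k ≠ i → k ≠ j → g k = f k) : ∏ k ∈ s, g k = ∏ k ∈ s, f k := by
  have hj' : j ∈ s.erase i := by simp [hj, hij.symm]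
  rw [← Finset.mul_prod_erase s g hi, ← Finset.mul_prod_erase s f hi,
    ← Finset.mul_prod_erase _ g hj', ← Finset.mul_prod_erase _ f hj', ← mul_assoc, ← mul_assoc, h]
  congr 1
  refine Finset.prod_congr rfl fun k hmem => ?_
  simp only [Finset.mem_erase] at hmem
  exact hk k hmem.2.1 hmem.1

/-- A family of sets, any two of which share fewer than `r - 1` elements. Its bases, the `r`-sets
that lie in no member of the family, are those of a paving matroid of rank `r`. -/
structure PavingSystem (α : Type*) where
  rank : ℕ
  hyp : Set (Finset α)
  eq_of_subset : ∀ H ∈ hyp, ∀ H' ∈ hyp, ∀ Y : Finset α, Y ⊆ H → Y ⊆ H' → Y.card + 1 = rank → H = H'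

namespace PavingSystem

variable {α : Type*} (P : PavingSystem α)

/-- The bases of a paving system. -/
def Base (X : Finset α) : Prop := X.card = P.rank ∧ ∀ H ∈ P.hyp, ¬ X ⊆ H

variable {P}

theorem exists_hyp_of_not_base {X : Finset α} (hX : X.card = P.rank) (h : ¬ P.Base X) :
    ∃ H ∈ P.hyp, X ⊆ H := by
  by_contra! h'
  exact h ⟨hX, h'⟩

variable [DecidableEq α]

theorem Base.exists_hyp_of_not_base_swap {A : Finset α} (hA : P.Base A) {a b : α} (ha : a ∈ A)
    (hb : b ∉ A) (h : ¬ P.Base (insert b (A.erase a))) :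
    ∃ H ∈ P.hyp, insert b (A.erase a) ⊆ H :=
  exists_hyp_of_not_base (by rw [Finset.card_insert_erase ha hb, hA.1]) h

theorem Base.card_inter_lt {A H : Finset α} (hA : P.Base A) (hH : H ∈ P.hyp) :
    (A ∩ H).card + 1 ≤ P.rank := by
  rw [← hA.1]
  refine Finset.card_lt_card ⟨Finset.inter_subset_left, fun h => hA.2 H hH ?_⟩
  exact fun x hx => (Finset.mem_inter.1 (h hx)).2

theorem Base.card_erase_add_one {A : Finset α} (hA : P.Base A) {a : α} (ha : a ∈ A) :
    (A.erase a).card + 1 = P.rank := by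
  rw [Finset.card_erase_add_one ha, hA.1]

theorem Base.eq_of_not_base_swap {A : Finset α} (hA : P.Base A) {a a' b : α} (ha : a ∈ A)
    (ha' : a' ∈ A) (hb : b ∉ A) (h : ¬ P.Base (insert b (A.erase a)))
    (h' : ¬ P.Base (insert b (A.erase a'))) : a = a' := by
  by_contra hne
  obtain ⟨H, hH, hs⟩ := hA.exists_hyp_of_not_base_swap ha hb h
  obtain ⟨H', hH', hs'⟩ := hA.exists_hyp_of_not_base_swap ha' hb h'
  have hmem : a' ∈ A.erase a := by simp [ha', Ne.symm hne]
  have hE : H = H' := by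
    refine P.eq_of_subset H hH H' hH' (insert b ((A.erase a).erase a')) ?_ ?_ ?_
    · refine subset_trans ?_ hs
      exact Finset.insert_subset_insert _ (Finset.erase_subset _ _)
    · refine subset_trans ?_ hs'
      rw [Finset.erase_right_comm]
      exact Finset.insert_subset_insert _ (Finset.erase_subset _ _)
    · rw [Finset.card_insert_erase hmem (by simp [hb]), hA.card_erase_add_one ha]
  subst hE
  refine hA.2 H hH fun x hx => ?_
  by_cases hxa : x = a
  · exact hs' (Finset.mem_insert_of_mem (Finset.mem_erase.2 ⟨hxa ▸ hne, hx⟩))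
  · exact hs (by simp [hx, hxa])

/-- A basis that drops an element `a` remains a basis after the addition of any element outside a
hyperplane that contains the rest. -/
theorem Base.swap_of_notMem {A H : Finset α} {a b : α} (hA : A.card = P.rank) (ha : a ∈ A)
    (hH : H ∈ P.hyp) (hs : A.erase a ⊆ H) (hbA : b ∉ A) (hb : b ∉ H) :
    P.Base (insert b (A.erase a)) := by
  refine ⟨by rw [Finset.card_insert_erase ha hbA, hA], fun K hK hsK => hb ?_⟩
  have : K = H := P.eq_of_subset K hK H hH (A.erase a)
    ((Finset.subset_insert _ _).trans hsK) hs (by rw [Finset.card_erase_add_one ha, hA])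
  exact this ▸ hsK (Finset.mem_insert_self _ _)

theorem Base.symm_exchange {C L : Finset α} (hC : P.Base C) (hL : P.Base L) {a : α} (ha : a ∈ C)
    (haL : a ∉ L) : ∃ y ∈ L, y ∉ C ∧ P.Base (insert y (C.erase a)) ∧
      P.Base (insert a (L.erase y)) := by
  by_contra! hbad
  by_cases hK : ∃ K ∈ P.hyp, C.erase a ⊆ K
  · obtain ⟨K, hK, hs⟩ := hK
    have out : ∀ y ∈ L, y ∉ K → ¬ P.Base (insert a (L.erase y)) := fun y hy hyK => by
      have hyC : y ∉ C := fun h => hyK (hs (by simp [h]; rintro rfl; exact haL hy))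
      exact hbad y hy hyC (swap_of_notMem hC.1 ha hK hs hyC hyK)
    obtain ⟨y₀, hy₀, hy₀K⟩ := Finset.not_subset.1 (hL.2 K hK)
    have hLK : L.erase y₀ ⊆ K := by
      intro y hy
      by_contra hyK
      have hy' := Finset.mem_erase.1 hy
      exact hy'.1 (hL.eq_of_not_base_swap hy'.2 hy₀ haL (out y hy'.2 hyK) (out y₀ hy₀ hy₀K))
    obtain ⟨K', hK', hs'⟩ := hL.exists_hyp_of_not_base_swap hy₀ haL (out y₀ hy₀ hy₀K)
    have : K = K' := P.eq_of_subset K hK K' hK' _ hLK ((Finset.subset_insert _ _).trans hs')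
      (hL.card_erase_add_one hy₀)
    subst this
    refine hC.2 K hK fun x hx => ?_
    by_cases hxa : x = a
    · exact hxa ▸ hs' (Finset.mem_insert_self _ _)
    · exact hs (by simp [hx, hxa])
  · push Not at hK
    have hcard : (C \ L).card = (L \ C).card := Finset.card_sdiff_comm (hC.1.trans hL.1.symm)
    have hpos : 0 < (L \ C).card := hcard ▸ Finset.card_pos.2 ⟨a, by simp [ha, haL]⟩
    obtain ⟨y, hy⟩ := Finset.card_pos.1 hpos
    have out : ∀ y ∈ L, y ∉ C → ¬ P.Base (insert a (L.erase y)) := fun y hy hyC => by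
      refine hbad y hy hyC ⟨by rw [Finset.card_insert_erase ha hyC, hC.1], fun H hH h => ?_⟩
      exact hK H hH ((Finset.subset_insert _ _).trans h)
    rw [Finset.mem_sdiff] at hy
    have huniq : ∀ y' ∈ L \ C, y' = y := fun y' hy' => by
      rw [Finset.mem_sdiff] at hy'
      exact hL.eq_of_not_base_swap hy'.1 hy.1 haL (out y' hy'.1 hy'.2) (out y hy.1 hy.2)
    have h1 : L \ C ⊆ {y} := fun y' hy' => by simp [huniq y' hy']
    have hsub : insert a (L.erase y) ⊆ C := by
      intro x hx
      rcases Finset.mem_insert.1 hx with rfl | hx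
      · exact ha
      · by_contra hxC
        rw [Finset.mem_erase] at hx
        exact hx.1 (huniq x (by simp [hx.2, hxC]))
    refine out y hy.1 hy.2 ?_
    rwa [Finset.eq_of_subset_of_card_le hsub
      (by rw [Finset.card_insert_erase hy.1 haL, hC.1, hL.1])]

/-- If exchanging `b` for `a` in `C` gives a subset of the hyperplane `H` and `L` has two elements
outside `H`, then an exchange between `C` and `L` makes the former exchange possible. -/
theorem Base.exists_exchange_off_hyp {C L H : Finset α} (hC : P.Base C) (hL : P.Base L)
    (hH : H ∈ P.hyp) {a b : α} (hb : b ∈ C) (hs : insert a (C.erase b) ⊆ H)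
    (hLH : (L ∩ H).card + 2 ≤ P.rank) :
    ∃ x ∈ C, x ∉ L ∧ x ≠ b ∧ ∃ y ∈ L, y ∉ C ∧ y ∉ H ∧ P.Base (insert y (C.erase x)) ∧
      P.Base (insert x (L.erase y)) := by
  have hbH : b ∉ H := fun h => hC.2 H hH fun x hx => by
    by_cases hxb : x = b
    · exact hxb ▸ h
    · exact hs (by simp [hx, hxb])
  have hCH : ∀ x ∈ C, x ≠ b → x ∈ H := fun x hx hxb => hs (by simp [hx, hxb])
  have hLcard : (L \ H).card + (L ∩ H).card = P.rank := by
    rw [Finset.card_sdiff_add_card_inter, hL.1]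
  by_cases hbL : b ∈ L
  · have : 1 < (L \ H).card := by omega
    obtain ⟨y, hy, hyb⟩ := Finset.exists_mem_ne this b
    rw [Finset.mem_sdiff] at hy
    have hyC : y ∉ C := fun h => hy.2 (hCH y h hyb)
    obtain ⟨x, hx, hxL, h1, h2⟩ := hL.symm_exchange hC hy.1 hyC
    exact ⟨x, hx, hxL, fun h => hxL (h ▸ hbL), y, hy.1, hyC, hy.2, h2, h1⟩
  by_contra! hbad
  have hLC : ∀ y ∈ L, y ∉ H → y ∉ C := fun y hy hyH h => hyH (hCH y h (fun e => hbL (e ▸ hy)))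
  have hsub : L \ H ⊆ L \ C := fun y hy => by
    rw [Finset.mem_sdiff] at hy ⊢
    exact ⟨hy.1, hLC y hy.1 hy.2⟩
  have hcard : (C \ L).card = (L \ C).card := Finset.card_sdiff_comm (hC.1.trans hL.1.symm)
  have hbmem : b ∈ C \ L := by simp [hb, hbL]
  have hle := Finset.card_le_card hsub
  have her : ((C \ L).erase b).card + 1 = (L \ C).card := by
    rw [Finset.card_erase_add_one hbmem, hcard]
  have memP : ∀ {x}, x ∈ (C \ L).erase b → x ∈ C ∧ x ∉ L ∧ x ≠ b := fun {x} hx => by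
    simp only [Finset.mem_erase, Finset.mem_sdiff] at hx
    tauto
  have memY : ∀ {y}, y ∈ L \ H → y ∈ L ∧ y ∉ H ∧ y ∉ C := fun {y} hy => by
    rw [Finset.mem_sdiff] at hy
    exact ⟨hy.1, hy.2, hLC y hy.1 hy.2⟩
  have bad : ∀ {x y}, x ∈ (C \ L).erase b → y ∈ L \ H →
      ¬ P.Base (insert y (C.erase x)) ∨ ¬ P.Base (insert x (L.erase y)) := fun {x y} hx hy => by
    obtain ⟨h1, h2, h3⟩ := memP hx
    obtain ⟨h4, h5, h6⟩ := memY hy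
    by_cases h : P.Base (insert y (C.erase x))
    · exact Or.inr (hbad x h1 h2 h3 y h4 h6 h5 h)
    · exact Or.inl h
  have uniqC : ∀ {x x' y}, x ∈ (C \ L).erase b → x' ∈ (C \ L).erase b → y ∈ L \ H →
      ¬ P.Base (insert y (C.erase x)) → ¬ P.Base (insert y (C.erase x')) → x = x' :=
    fun hx hx' hy => hC.eq_of_not_base_swap (memP hx).1 (memP hx').1 (memY hy).2.2
  have uniqL : ∀ {x y y'}, x ∈ (C \ L).erase b → y ∈ L \ H → y' ∈ L \ H →
      ¬ P.Base (insert x (L.erase y)) → ¬ P.Base (insert x (L.erase y')) → y = y' :=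
    fun hx hy hy' => hL.eq_of_not_base_swap (memY hy).1 (memY hy').1 (memP hx).2.1
  rcases hLH.eq_or_lt with heq | hlt
  · have hLbase : ∀ {x y}, x ∈ (C \ L).erase b → y ∈ L \ H → P.Base (insert x (L.erase y)) := by
      intro x y hx hy
      by_contra hn
      obtain ⟨h1, h2, h3⟩ := memP hx
      obtain ⟨K, hK, hsK⟩ := hL.exists_hyp_of_not_base_swap (memY hy).1 h2 hn
      have : K = H := by
        refine P.eq_of_subset K hK H hH (insert x (L ∩ H)) ?_ ?_ ?_
        · refine subset_trans (Finset.insert_subset_insert _ fun e he => ?_) hsK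
          rw [Finset.mem_inter] at he
          rw [Finset.mem_erase]
          exact ⟨fun h => (memY hy).2.1 (h ▸ he.2), he.1⟩
        · exact Finset.insert_subset (hCH x h1 h3) Finset.inter_subset_right
        · rw [Finset.card_insert_of_notMem (by simp [h2])]
          omega
      have h1 : 1 < (L \ H).card := by omega
      obtain ⟨y', hy', hne⟩ := Finset.exists_mem_ne h1 y
      exact (memY hy').2.1 (this ▸ hsK (by simp [hne, (memY hy').1]))
    have h2 : (L \ H).card = 2 := by omega
    obtain ⟨y₁, y₂, hne, hY⟩ := Finset.card_eq_two.1 h2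
    have hy₁ : y₁ ∈ L \ H := by simp [hY]
    have hy₂ : y₂ ∈ L \ H := by simp [hY]
    obtain ⟨x, hx⟩ := Finset.card_pos.1 (show 0 < ((C \ L).erase b).card by omega)
    have b1 := (bad hx hy₁).resolve_right (not_not.2 (hLbase hx hy₁))
    have b2 := (bad hx hy₂).resolve_right (not_not.2 (hLbase hx hy₂))
    have honly : ∀ x' ∈ (C \ L).erase b, x' = x := fun x' hx' => by
      have := (bad hx' hy₁).resolve_right (not_not.2 (hLbase hx' hy₁))
      exact uniqC hx' hx hy₁ this b1
    have hone : ((C \ L).erase b).card ≤ 1 :=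
      Finset.card_le_one.2 fun u hu v hv => (honly u hu).trans (honly v hv).symm
    have hEq : L \ H = L \ C := Finset.eq_of_subset_of_card_le hsub (by omega)
    obtain ⟨K₁, hK₁, hs₁⟩ := hC.exists_hyp_of_not_base_swap (memP hx).1 (memY hy₁).2.2 b1
    obtain ⟨K₂, hK₂, hs₂⟩ := hC.exists_hyp_of_not_base_swap (memP hx).1 (memY hy₂).2.2 b2
    have : K₁ = K₂ := P.eq_of_subset _ hK₁ _ hK₂ _ ((Finset.subset_insert _ _).trans hs₁)
      ((Finset.subset_insert _ _).trans hs₂) (hC.card_erase_add_one (memP hx).1)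
    subst this
    refine hL.2 K₁ hK₁ fun e he => ?_
    by_cases heC : e ∈ C
    · exact hs₁ (by simp [heC]; right; rintro rfl; exact (memP hx).2.1 he)
    · have : e ∈ L \ H := by rw [hEq]; simp [he, heC]
      rw [hY] at this
      simp only [Finset.mem_insert, Finset.mem_singleton] at this
      rcases this with rfl | rfl
      · exact hs₁ (by simp)
      · exact hs₂ (by simp)
  · obtain ⟨y₁, y₂, y₃, hy₁, hy₂, hy₃, h12, h13, h23⟩ :=
      Finset.two_lt_card_iff.1 (show 2 < (L \ H).card by omega)
    obtain ⟨x₁, hx₁, x₂, hx₂, hx⟩ :=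
      Finset.one_lt_card.1 (show 1 < ((C \ L).erase b).card by omega)
    have c : ∀ {y}, y ∈ L \ H →
        ¬ P.Base (insert x₁ (L.erase y)) ∨ ¬ P.Base (insert x₂ (L.erase y)) := fun {y} hy => by
      by_contra! h
      exact hx (uniqC hx₁ hx₂ hy ((bad hx₁ hy).resolve_right (not_not.2 h.1))
        ((bad hx₂ hy).resolve_right (not_not.2 h.2)))
    rcases c hy₁ with h1 | h1 <;> rcases c hy₂ with h2 | h2 <;> rcases c hy₃ with h3 | h3 <;>
      first
      | exact h12 (uniqL hx₁ hy₁ hy₂ h1 h2)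
      | exact h12 (uniqL hx₂ hy₁ hy₂ h1 h2)
      | exact h13 (uniqL hx₁ hy₁ hy₃ h1 h3)
      | exact h13 (uniqL hx₂ hy₁ hy₃ h1 h3)
      | exact h23 (uniqL hx₁ hy₂ hy₃ h2 h3)
      | exact h23 (uniqL hx₂ hy₂ hy₃ h2 h3)

end PavingSystem

namespace PavingSystem

variable {α ι : Type*} [DecidableEq α] {P : PavingSystem α}

/-- A symmetric exchange between two members of a tuple of bases. -/
def Step (P : PavingSystem α) (S T : ι → Finset α) : Prop :=
  (∀ k, P.Base (S k)) ∧ (∀ k, P.Base (T k)) ∧ ∃ i j, i ≠ j ∧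
    (∃ a ∈ S i, a ∉ S j ∧ ∃ b ∈ S j, b ∉ S i ∧
      T i = insert b ((S i).erase a) ∧ T j = insert a ((S j).erase b)) ∧
    ∀ k, k ≠ i → k ≠ j → T k = S k

theorem Step.symm {S T : ι → Finset α} (h : P.Step S T) : P.Step T S := by
  obtain ⟨hS, hT, i, j, hij, ⟨a, ha, haj, b, hb, hbi, hTi, hTj⟩, hk⟩ := h
  have hab : a ≠ b := fun h => haj (h ▸ hb)
  refine ⟨hT, hS, i, j, hij, ⟨b, by simp [hTi], by simp [hTj, hab.symm], a, by simp [hTj],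
    by simp [hTi, hab], ?_, ?_⟩, fun k h1 h2 => (hk k h1 h2).symm⟩
  · rw [hTi, Finset.erase_insert (by simp [hbi]), Finset.insert_erase ha]
  · rw [hTj, Finset.erase_insert (by simp [haj]), Finset.insert_erase hb]

/-- Connection by a sequence of symmetric exchanges. -/
def Conn (P : PavingSystem α) : (ι → Finset α) → (ι → Finset α) → Prop :=
  Relation.ReflTransGen P.Step

theorem Conn.symm {S T : ι → Finset α} (h : P.Conn S T) : P.Conn T S :=
  haveI : Std.Symm (P.Step (ι := ι)) := ⟨fun _ _ => Step.symm⟩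
  Relation.ReflTransGen.stdSymm.symm _ _ h

theorem Conn.trans {S T U : ι → Finset α} (h : P.Conn S T) (h' : P.Conn T U) : P.Conn S U :=
  Relation.ReflTransGen.trans h h'

theorem Conn.base {S T : ι → Finset α} (h : P.Conn S T) (hS : ∀ k, P.Base (S k)) :
    ∀ k, P.Base (T k) := by
  induction h with
  | refl => exact hS
  | tail _ h _ => exact h.2.1

theorem card_inter_swap {A C X : Finset α} {a b : α} (ha : a ∈ A) (haC : a ∉ C) (hb : b ∈ C)
    (hbA : b ∉ A) : (insert b (A.erase a) ∩ X).card + (insert a (C.erase b) ∩ X).card =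
      (A ∩ X).card + (C ∩ X).card := by
  rw [← Finset.card_union_add_card_inter, ← Finset.card_union_add_card_inter (A ∩ X)]
  congr 2 <;> ext x <;> simp only [Finset.mem_union, Finset.mem_inter, Finset.mem_insert,
    Finset.mem_erase] <;> by_cases h1 : x = a <;> by_cases h2 : x = b <;> (try subst h1) <;>
    (try subst h2) <;> simp_all

/-- A hyperplane that meets each `S j` with `j ∈ t` in as many elements as it can. -/
def Tight (P : PavingSystem α) (t : Finset ι) (S : ι → Finset α) (H : Finset α) : Prop :=
  H ∈ P.hyp ∧ ∀ j ∈ t, (S j ∩ H).card + 1 = P.rank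

theorem tight_of_sum_le {S T : ι → Finset α} {t : Finset ι} {H : Finset α} (hS : P.Tight t S H)
    (hT : ∀ k, P.Base (T k))
    (h : ∑ k ∈ t, (S k ∩ H).card ≤ ∑ k ∈ t, (T k ∩ H).card) : P.Tight t T H := by
  have hle : ∀ k ∈ t, (T k ∩ H).card ≤ (S k ∩ H).card := fun k hk => by
    have := (hT k).card_inter_lt hS.1
    have := hS.2 k hk
    omega
  have heq := (Finset.sum_eq_sum_iff_of_le hle).1 (le_antisymm (Finset.sum_le_sum hle) h)
  exact ⟨hS.1, fun j hj => heq j hj ▸ hS.2 j hj⟩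

variable [DecidableEq ι]

theorem Step.sum_inter {S T : ι → Finset α} (h : P.Step S T) [Fintype ι] (X : Finset α) :
    ∑ k, (T k ∩ X).card = ∑ k, (S k ∩ X).card := by
  obtain ⟨hS, hT, i, j, hij, ⟨a, ha, haj, b, hb, hbi, hTi, hTj⟩, hk⟩ := h
  refine Finset.sum_eq_of_pair (Finset.mem_univ i) (Finset.mem_univ j) hij ?_
    fun k h1 h2 => by rw [hk k h1 h2]
  rw [hTi, hTj, card_inter_swap ha haj hb hbi]

theorem Conn.sum_inter {S T : ι → Finset α} (h : P.Conn S T) [Fintype ι] (X : Finset α) :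
    ∑ k, (T k ∩ X).card = ∑ k, (S k ∩ X).card := by
  induction h with
  | refl => rfl
  | tail _ h ih => rw [h.sum_inter, ih]

/-- A symmetric exchange between the members `i` and `j` of a tuple of bases. -/
theorem exists_step {S : ι → Finset α} (hS : ∀ k, P.Base (S k)) {i j : ι} (hij : i ≠ j) {a b : α}
    (ha : a ∈ S i) (haj : a ∉ S j) (hb : b ∈ S j) (hbi : b ∉ S i)
    (h1 : P.Base (insert b ((S i).erase a))) (h2 : P.Base (insert a ((S j).erase b))) :
    ∃ T, P.Step S T ∧ (∀ k, P.Base (T k)) ∧ T i = insert b ((S i).erase a) ∧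
      T j = insert a ((S j).erase b) ∧ ∀ k, k ≠ i → k ≠ j → T k = S k := by
  let T : ι → Finset α := fun k => if k = i then insert b ((S i).erase a) else
    if k = j then insert a ((S j).erase b) else S k
  have hTi : T i = insert b ((S i).erase a) := by simp [T]
  have hTj : T j = insert a ((S j).erase b) := by simp [T, hij.symm]
  have hTk : ∀ k, k ≠ i → k ≠ j → T k = S k := fun k h1 h2 => by simp [T, h1, h2]
  have hT : ∀ k, P.Base (T k) := fun k => by
    by_cases hki : k = i
    · rw [hki, hTi]; exact h1
    by_cases hkj : k = j
    · rw [hkj, hTj]; exact h2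
    rw [hTk k hki hkj]; exact hS k
  exact ⟨T, ⟨hS, hT, i, j, hij, ⟨a, ha, haj, b, hb, hbi, hTi, hTj⟩, hTk⟩, hT, hTi, hTj, hTk⟩

theorem exists_conn_swap_aux {S : ι → Finset α} (hS : ∀ k, P.Base (S k)) {i : ι} {t : Finset ι}
    (hi : i ∉ t) {a b : α} (ha : a ∈ S i) (hb : b ∉ S i)
    (hbase : P.Base (insert b ((S i).erase a))) {j : ι} (hj : j ∈ t) (hbj : b ∈ S j)
    (haj : a ∉ S j) (hslack : ∀ H, P.Tight t S H → a ∈ H → b ∈ H) :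
    ∃ S', P.Conn S S' ∧ (∀ k, k ≠ i → k ∉ t → S' k = S k) ∧
      S' i = insert b ((S i).erase a) := by
  have hij : i ≠ j := fun h => hi (h ▸ hj)
  by_cases hd : P.Base (insert a ((S j).erase b))
  · obtain ⟨T, hT, -, hTi, -, hTk⟩ := exists_step hS hij ha haj hbj hb hbase hd
    exact ⟨T, .single hT, fun k h1 h2 => hTk k h1 (fun h => h2 (h ▸ hj)), hTi⟩
  obtain ⟨H, hH, hs⟩ := (hS j).exists_hyp_of_not_base_swap hbj haj hd
  have haH : a ∈ H := hs (by simp)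
  have hCH : ∀ x ∈ S j, x ≠ b → x ∈ H := fun x hx hxb => hs (by simp [hx, hxb])
  have hbH : b ∉ H := fun h => (hS j).2 H hH fun x hx => by
    by_cases hxb : x = b
    · exact hxb ▸ h
    · exact hCH x hx hxb
  obtain ⟨l, hl, hlH⟩ : ∃ l ∈ t, (S l ∩ H).card + 2 ≤ P.rank := by
    by_contra! h
    refine hbH (hslack H ⟨hH, fun k hk => ?_⟩ haH)
    have := h k hk
    have := (hS k).card_inter_lt hH
    omega
  have hjl : j ≠ l := by
    rintro rfl
    have h1 : (S j).erase b ⊆ S j ∩ H := fun x hx => by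
      rw [Finset.mem_erase] at hx
      exact Finset.mem_inter.2 ⟨hx.2, hCH x hx.2 hx.1⟩
    have := Finset.card_le_card h1
    have := (hS j).card_erase_add_one hbj
    omega
  obtain ⟨x, hx, hxl, hxb, y, hy, hyj, hyH, h1, h2⟩ :=
    (hS j).exists_exchange_off_hyp (hS l) hH hbj hs hlH
  obtain ⟨S₁, hS₁, hB₁, h1j, -, h1k⟩ := exists_step hS hjl hx hxl hy hyj h1 h2
  have h1i : S₁ i = S i := h1k i hij (fun h => hi (h ▸ hl))
  have hay : a ≠ y := fun h => hyH (h ▸ haH)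
  have hb1 : b ∈ S₁ j := by simp [h1j, hxb.symm, hbj]
  have ha1 : a ∉ S₁ j := by simp [h1j, hay, haj]
  have hxE : x ∈ insert a ((S j).erase b) := by simp [hx, hxb]
  have hxa : x ≠ a := fun h => haj (h ▸ hx)
  have hbase1 : P.Base (insert a ((S₁ j).erase b)) := by
    have : insert a ((S₁ j).erase b) = insert y ((insert a ((S j).erase b)).erase x) := by
      rw [h1j]
      ext e
      have hyb : y ≠ b := fun h => hyj (h ▸ hbj)
      simp only [Finset.mem_insert, Finset.mem_erase]
      constructor
      · rintro (rfl | ⟨h1, rfl | h2⟩)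
        · exact Or.inr ⟨hxa.symm, Or.inl rfl⟩
        · exact Or.inl rfl
        · exact Or.inr ⟨h2.1, Or.inr ⟨h1, h2.2⟩⟩
      · rintro (rfl | ⟨h1, rfl | h2⟩)
        · exact Or.inr ⟨hyb, Or.inl rfl⟩
        · exact Or.inl rfl
        · exact Or.inr ⟨h2.1, Or.inr ⟨h1, h2.2⟩⟩
    rw [this]
    refine Base.swap_of_notMem ?_ hxE hH ((Finset.erase_subset _ _).trans hs) ?_ hyH
    · rw [Finset.card_insert_erase hbj haj, (hS j).1]
    · exact fun h => hyH (hs h)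
  obtain ⟨T, hT, -, hTi, -, hTk⟩ := exists_step hB₁ hij (h1i ▸ ha) ha1 hb1 (h1i ▸ hb)
    (h1i ▸ hbase) hbase1
  refine ⟨T, .tail (.single hS₁) hT, fun k hk hkt => ?_, h1i ▸ hTi⟩
  have hkj : k ≠ j := fun h => hkt (h ▸ hj)
  rw [hTk k hk hkj, h1k k hkj (fun h => hkt (h ▸ hl))]

/-- The member `i` of a tuple of bases can drop `a` and gain `b` if the result is a basis, unless
this is prevented by a tight hyperplane or by the multiplicities of `a` and `b`. -/
theorem exists_conn_swap {S : ι → Finset α} (hS : ∀ k, P.Base (S k)) {i : ι} {t : Finset ι}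
    (hi : i ∉ t) {a b : α} (ha : a ∈ S i) (hb : b ∉ S i)
    (hbase : P.Base (insert b ((S i).erase a))) (hbt : ∃ j ∈ t, b ∈ S j) (hat : ∃ l ∈ t, a ∉ S l)
    (hslack : ∀ H, P.Tight t S H → a ∈ H → b ∈ H) :
    ∃ S', P.Conn S S' ∧ (∀ k, k ≠ i → k ∉ t → S' k = S k) ∧
      S' i = insert b ((S i).erase a) := by
  obtain ⟨j, hj, hbj⟩ := hbt
  obtain ⟨l, hl, hal⟩ := hat
  by_cases haj : a ∈ S j
  swap
  · exact exists_conn_swap_aux hS hi ha hb hbase hj hbj haj hslack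
  by_cases hbl : b ∈ S l
  · exact exists_conn_swap_aux hS hi ha hb hbase hl hbl hal hslack
  have hjl : j ≠ l := fun h => hal (h ▸ haj)
  obtain ⟨y, hy, hyj, h1, h2⟩ := (hS j).symm_exchange (hS l) haj hal
  obtain ⟨S₁, hS₁, hB₁, h1j, h1l, h1k⟩ := exists_step hS hjl haj hal hy hyj h1 h2
  have h1i : S₁ i = S i := h1k i (fun h => hi (h ▸ hj)) (fun h => hi (h ▸ hl))
  have hab : a ≠ b := fun h => hb (h ▸ ha)
  have hay : a ≠ y := fun h => hyj (h ▸ haj)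
  obtain ⟨S', hS', hk', hi'⟩ := exists_conn_swap_aux hB₁ hi (h1i ▸ ha) (h1i ▸ hb) (h1i ▸ hbase) hj
    (by simp [h1j, hbj, hab.symm]) (by simp [h1j, hay]) (fun H hH => hslack H
      (tight_of_sum_le hH hS (le_of_eq (Finset.sum_eq_of_pair hj hl hjl (by
        rw [h1j, h1l, card_inter_swap haj hal hy hyj]) fun k h1 h2 => by rw [h1k k h1 h2]))))
  refine ⟨S', .trans (.single hS₁) hS', fun k hk hkt => ?_, h1i ▸ hi'⟩
  rw [hk' k hk hkt, h1k k (fun h => hkt (h ▸ hj)) (fun h => hkt (h ▸ hl))]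

end PavingSystem

namespace PavingSystem

variable {α ι : Type*} [DecidableEq α] {P : PavingSystem α}

section Tight

variable {S T : ι → Finset α} {t : Finset ι}

theorem Tight.card_inter_add_two {H H' : Finset α} (hS : ∀ k, P.Base (S k)) (ht : t.Nonempty)
    (h : P.Tight t S H) (h' : P.Tight t S H') (hne : H ≠ H') :
    (H ∩ H').card + 2 = P.rank ∧ ∀ j ∈ t, S j ⊆ H ∪ H' ∧ H ∩ H' ⊆ S j := by
  have hsmall : (H ∩ H').card + 2 ≤ P.rank := by
    by_contra hc
    obtain ⟨j, hj⟩ := ht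
    have h1 := h.2 j hj
    obtain ⟨Y, hY, hYc⟩ := Finset.exists_subset_card_eq
      (show (S j ∩ H).card ≤ (H ∩ H').card by omega)
    exact hne (P.eq_of_subset H h.1 H' h'.1 Y (hY.trans Finset.inter_subset_left)
      (hY.trans Finset.inter_subset_right) (by rw [hYc, h1]))
  have key : ∀ j ∈ t, (S j ∩ (H ∩ H')).card + 2 = P.rank ∧ (S j ∩ (H ∪ H')).card = P.rank := by
    intro j hj
    have h1 := h.2 j hj
    have h2 := h'.2 j hj
    have h3 := Finset.card_union_add_card_inter (S j ∩ H) (S j ∩ H')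
    rw [← Finset.inter_union_distrib_left, ← Finset.inter_inter_distrib_left] at h3
    have h4 := Finset.card_le_card (Finset.inter_subset_left (s₁ := S j) (s₂ := H ∪ H'))
    have h5 := Finset.card_le_card (Finset.inter_subset_right (s₁ := S j) (s₂ := H ∩ H'))
    rw [(hS j).1] at h4
    omega
  refine ⟨?_, fun j hj => ⟨?_, ?_⟩⟩
  · obtain ⟨j, hj⟩ := ht
    have h1 := (key j hj).1
    have h5 := Finset.card_le_card (Finset.inter_subset_right (s₁ := S j) (s₂ := H ∩ H'))
    omega
  · have := Finset.eq_of_subset_of_card_le (Finset.inter_subset_left (s₁ := S j) (s₂ := H ∪ H'))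
      (by rw [(key j hj).2, (hS j).1])
    exact Finset.inter_eq_left.1 this
  · have h1 := (key j hj).1
    have := Finset.eq_of_subset_of_card_le (Finset.inter_subset_right (s₁ := S j) (s₂ := H ∩ H'))
      (by omega)
    exact Finset.inter_eq_right.1 this

theorem Tight.eq_of_mem {H H' : Finset α} (hS : ∀ k, P.Base (S k)) (h : P.Tight t S H)
    (h' : P.Tight t S H') {a : α} (ha : a ∈ H) (ha' : a ∈ H') (hat : ∃ l ∈ t, a ∉ S l) :
    H = H' := by
  by_contra hne
  obtain ⟨l, hl, hal⟩ := hat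
  exact hal (((h.card_inter_add_two hS ⟨l, hl⟩ h' hne).2 l hl).2 (Finset.mem_inter.2 ⟨ha, ha'⟩))

end Tight

theorem exists_mem_of_sum_inter {S T : ι → Finset α} {i : ι} {t : Finset ι}
    (hsum : ∀ X, (S i ∩ X).card + ∑ j ∈ t, (S j ∩ X).card =
      (T i ∩ X).card + ∑ j ∈ t, (T j ∩ X).card) {b : α} (hb : b ∈ T i) (hbS : b ∉ S i) :
    ∃ j ∈ t, b ∈ S j := by
  by_contra! h
  have h1 := hsum {b}
  rw [Finset.inter_singleton_of_mem hb, Finset.inter_singleton_of_notMem hbS,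
    Finset.sum_eq_zero fun j hj => by rw [Finset.inter_singleton_of_notMem (h j hj)]; rfl] at h1
  simp at h1
  omega

theorem exists_notMem_of_sum_inter {S T : ι → Finset α} {i : ι} {t : Finset ι}
    (hsum : ∀ X, (S i ∩ X).card + ∑ j ∈ t, (S j ∩ X).card =
      (T i ∩ X).card + ∑ j ∈ t, (T j ∩ X).card) {a : α} (ha : a ∈ S i) (haT : a ∉ T i) :
    ∃ j ∈ t, a ∉ S j := by
  by_contra! h
  have h1 := hsum {a}
  rw [Finset.inter_singleton_of_mem ha, Finset.inter_singleton_of_notMem haT,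
    Finset.sum_congr rfl fun j hj => by rw [Finset.inter_singleton_of_mem (h j hj)]] at h1
  have h2 : ∑ j ∈ t, (T j ∩ {a}).card ≤ ∑ j ∈ t, ({a} : Finset α).card :=
    Finset.sum_le_sum fun j _ => Finset.card_le_card Finset.inter_subset_right
  simp only [Finset.card_singleton, Finset.card_empty] at h1 h2
  omega

theorem card_sdiff_inter_add (A B H : Finset α) :
    ((A \ B) ∩ H).card + (A ∩ B ∩ H).card = (A ∩ H).card := by
  rw [← Finset.card_union_of_disjoint]
  · rw [← Finset.union_inter_distrib_right, Finset.sdiff_union_inter]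
  · rw [Finset.disjoint_left]
    intro x
    simp only [Finset.mem_inter, Finset.mem_sdiff]
    tauto

theorem Tight.card_inter_sdiff_le {S T : ι → Finset α} {i : ι} {t : Finset ι}
    (hsum : ∀ X, (S i ∩ X).card + ∑ j ∈ t, (S j ∩ X).card =
      (T i ∩ X).card + ∑ j ∈ t, (T j ∩ X).card) (hT : ∀ k, P.Base (T k)) {H : Finset α}
    (h : P.Tight t S H) : ((S i \ T i) ∩ H).card ≤ ((T i \ S i) ∩ H).card := by
  have h1 : ∑ j ∈ t, (T j ∩ H).card ≤ ∑ j ∈ t, (S j ∩ H).card := Finset.sum_le_sum fun j hj => by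
    have := h.2 j hj
    have := (hT j).card_inter_lt h.1
    omega
  have h2 := hsum H
  have h4 := card_sdiff_inter_add (S i) (T i) H
  have h5 := card_sdiff_inter_add (T i) (S i) H
  rw [Finset.inter_comm (T i)] at h5
  omega

/-- Two tuples that differ at `i` and have no admissible swap at `i` differ there in exactly two
elements, which are separated by two tight hyperplanes. -/
theorem exists_tight_pair_of_no_swap {S T : ι → Finset α} {i : ι} {t : Finset ι}
    (hS : ∀ k, P.Base (S k)) (hT : ∀ k, P.Base (T k))
    (hsum : ∀ X, (S i ∩ X).card + ∑ j ∈ t, (S j ∩ X).card =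
      (T i ∩ X).card + ∑ j ∈ t, (T j ∩ X).card) (hne : S i ≠ T i)
    (hbad : ∀ a ∈ S i \ T i, ∀ b ∈ T i \ S i, P.Base (insert b ((S i).erase a)) →
      ∃ H, P.Tight t S H ∧ a ∈ H ∧ b ∉ H) :
    ∃ a₁ a₂ b₁ b₂ H₁ H₂, S i \ T i = {a₁, a₂} ∧ T i \ S i = {b₁, b₂} ∧ a₁ ≠ a₂ ∧
      ¬ P.Base (insert b₁ ((S i).erase a₁)) ∧ ¬ P.Base (insert b₂ ((S i).erase a₂)) ∧
      P.Tight t S H₁ ∧ P.Tight t S H₂ ∧ a₁ ∈ H₁ ∧ b₁ ∈ H₁ ∧ a₂ ∉ H₁ ∧ b₂ ∉ H₁ ∧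
      a₂ ∈ H₂ ∧ b₂ ∈ H₂ ∧ a₁ ∉ H₂ ∧ b₁ ∉ H₂ := by
  set D := S i \ T i with hD
  set D' := T i \ S i with hD'
  have memD : ∀ {x}, x ∈ D → x ∈ S i ∧ x ∉ T i := fun {x} hx => Finset.mem_sdiff.1 hx
  have memD' : ∀ {x}, x ∈ D' → x ∈ T i ∧ x ∉ S i := fun {x} hx => Finset.mem_sdiff.1 hx
  have hcard : D.card = D'.card := Finset.card_sdiff_comm ((hS i).1.trans (hT i).1.symm)
  have hat : ∀ {a}, a ∈ D → ∃ l ∈ t, a ∉ S l := fun {a} ha =>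
    exists_notMem_of_sum_inter hsum (memD ha).1 (memD ha).2
  have hbt : ∀ {b}, b ∈ D' → ∃ j ∈ t, b ∈ S j := fun {b} hb =>
    exists_mem_of_sum_inter hsum (memD' hb).1 (memD' hb).2
  have hle : ∀ {H}, P.Tight t S H → (D ∩ H).card ≤ (D' ∩ H).card := fun {H} h =>
    h.card_inter_sdiff_le hsum hT
  have hpt : ∀ {H a}, P.Tight t S H → a ∈ D → a ∈ H → ∃ b ∈ D', b ∈ H := fun {H a} h ha haH => by
    have h1 : 0 < (D ∩ H).card := Finset.card_pos.2 ⟨a, Finset.mem_inter.2 ⟨ha, haH⟩⟩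
    obtain ⟨b, hb⟩ := Finset.card_pos.1 (h1.trans_le (hle h))
    exact ⟨b, Finset.mem_inter.1 hb⟩
  have huniq : ∀ {a a' b}, a ∈ D → a' ∈ D → b ∈ D' → ¬ P.Base (insert b ((S i).erase a)) →
      ¬ P.Base (insert b ((S i).erase a')) → a = a' := fun ha ha' hb =>
    (hS i).eq_of_not_base_swap (memD ha).1 (memD ha').1 (memD' hb).2
  have hone : ∀ {H a a'}, P.Tight t S H → a ∈ D → a' ∈ D → a ∈ H → a' ∈ H → a = a' := by
    intro H a a' h ha ha' haH haH'
    obtain ⟨b, hb, hbH⟩ := hpt h ha haH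
    have nb : ∀ {x}, x ∈ D → x ∈ H → ¬ P.Base (insert b ((S i).erase x)) := fun {x} hx hxH hB => by
      obtain ⟨H', h', hxH', hbH'⟩ := hbad x hx b hb hB
      exact hbH' (h.eq_of_mem hS h' hxH hxH' (hat hx) ▸ hbH)
    exact huniq ha ha' hb (nb ha haH) (nb ha' haH')
  have huniq' : ∀ {a a' b}, a ∈ D → a' ∈ D → b ∈ D' → P.Base (insert b ((S i).erase a)) →
      P.Base (insert b ((S i).erase a')) → a = a' := by
    intro a a' b ha ha' hb hB hB'
    obtain ⟨H, h, haH, hbH⟩ := hbad a ha b hb hB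
    obtain ⟨H', h', haH', hbH'⟩ := hbad a' ha' b hb hB'
    by_cases he : H = H'
    · subst he
      exact hone h ha ha' haH haH'
    · obtain ⟨j, hj, hbj⟩ := hbt hb
      have := ((h.card_inter_add_two hS ⟨j, hj⟩ h' he).2 j hj).1 hbj
      rcases Finset.mem_union.1 this with h1 | h1
      · exact absurd h1 hbH
      · exact absurd h1 hbH'
  have hDne : D.Nonempty := by
    rw [Finset.nonempty_iff_ne_empty]
    intro h
    exact hne (Finset.eq_of_subset_of_card_le (Finset.sdiff_eq_empty_iff_subset.1 h)
      (by rw [(hS i).1, (hT i).1]))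
  have hD'ne : D'.Nonempty := by
    rw [← Finset.card_pos, ← hcard]
    exact Finset.card_pos.2 hDne
  have hle2 : D.card ≤ 2 := by
    by_contra! h
    obtain ⟨x, y, z, hx, hy, hz, hxy, hxz, hyz⟩ := Finset.two_lt_card_iff.1 h
    obtain ⟨b, hb⟩ := hD'ne
    by_cases h1 : P.Base (insert b ((S i).erase x)) <;>
      by_cases h2 : P.Base (insert b ((S i).erase y)) <;>
      by_cases h3 : P.Base (insert b ((S i).erase z)) <;>
      first
      | exact hxy (huniq' hx hy hb h1 h2)
      | exact hxz (huniq' hx hz hb h1 h3)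
      | exact hyz (huniq' hy hz hb h2 h3)
      | exact hxy (huniq hx hy hb h1 h2)
      | exact hxz (huniq hx hz hb h1 h3)
      | exact hyz (huniq hy hz hb h2 h3)
  have hne1 : D.card ≠ 1 := by
    intro h1
    obtain ⟨a, ha⟩ := Finset.card_eq_one.1 h1
    obtain ⟨b, hb⟩ := Finset.card_eq_one.1 (hcard ▸ h1)
    have haD : a ∈ D := by simp [ha]
    have hbD : b ∈ D' := by simp [hb]
    have hsub : insert b ((S i).erase a) ⊆ T i := by
      intro x hx
      rcases Finset.mem_insert.1 hx with rfl | hx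
      · exact (memD' hbD).1
      · by_contra hxT
        rw [Finset.mem_erase] at hx
        have : x ∈ D := Finset.mem_sdiff.2 ⟨hx.2, hxT⟩
        rw [ha, Finset.mem_singleton] at this
        exact hx.1 this
    have hEq := Finset.eq_of_subset_of_card_le hsub
      (by rw [Finset.card_insert_erase (memD haD).1 (memD' hbD).2, (hS i).1, (hT i).1])
    obtain ⟨H, h, haH, hbH⟩ := hbad a haD b hbD (hEq ▸ hT i)
    obtain ⟨b', hb', hbH'⟩ := hpt h haD haH
    rw [hb, Finset.mem_singleton] at hb'
    exact hbH (hb' ▸ hbH')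
  have h2 : D.card = 2 := by
    have := Finset.card_pos.2 hDne
    omega
  obtain ⟨b₁, b₂, -, hbD⟩ := Finset.card_eq_two.1 (hcard ▸ h2)
  have hb₁ : b₁ ∈ D' := by simp [hbD]
  have hb₂ : b₂ ∈ D' := by simp [hbD]
  obtain ⟨a₁, a₂, ha12, haD, hn1⟩ : ∃ a₁ a₂, a₁ ≠ a₂ ∧ D = {a₁, a₂} ∧
      ¬ P.Base (insert b₁ ((S i).erase a₁)) := by
    obtain ⟨a₁, a₂, ha12, haD⟩ := Finset.card_eq_two.1 h2
    by_cases h : P.Base (insert b₁ ((S i).erase a₁))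
    · exact ⟨a₂, a₁, ha12.symm, by rw [haD, Finset.pair_comm], fun h' =>
        ha12 (huniq' (by simp [haD]) (by simp [haD]) hb₁ h h')⟩
    · exact ⟨a₁, a₂, ha12, haD, h⟩
  have ha₁ : a₁ ∈ D := by simp [haD]
  have ha₂ : a₂ ∈ D := by simp [haD]
  have hB21 : P.Base (insert b₁ ((S i).erase a₂)) := by
    by_contra h
    exact ha12 (huniq ha₁ ha₂ hb₁ hn1 h)
  obtain ⟨H₂, hH₂, haH₂, hbH₂⟩ := hbad a₂ ha₂ b₁ hb₁ hB21
  have hb2H₂ : b₂ ∈ H₂ := by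
    obtain ⟨b, hb, hbH⟩ := hpt hH₂ ha₂ haH₂
    rw [hbD, Finset.mem_insert, Finset.mem_singleton] at hb
    rcases hb with rfl | rfl
    · exact absurd hbH hbH₂
    · exact hbH
  have hn2 : ¬ P.Base (insert b₂ ((S i).erase a₂)) := fun h => by
    obtain ⟨H, hH, haH, hbH⟩ := hbad a₂ ha₂ b₂ hb₂ h
    exact hbH (hH₂.eq_of_mem hS hH haH₂ haH (hat ha₂) ▸ hb2H₂)
  have hB12 : P.Base (insert b₂ ((S i).erase a₁)) := by
    by_contra h
    exact ha12 (huniq ha₁ ha₂ hb₂ h hn2)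
  obtain ⟨H₁, hH₁, haH₁, hbH₁⟩ := hbad a₁ ha₁ b₂ hb₂ hB12
  have hb1H₁ : b₁ ∈ H₁ := by
    obtain ⟨b, hb, hbH⟩ := hpt hH₁ ha₁ haH₁
    rw [hbD, Finset.mem_insert, Finset.mem_singleton] at hb
    rcases hb with rfl | rfl
    · exact hbH
    · exact absurd hbH hbH₁
  exact ⟨a₁, a₂, b₁, b₂, H₁, H₂, haD, hbD, ha12, hn1, hn2, hH₁, hH₂, haH₁, hb1H₁,
    fun h => ha12 (hone hH₁ ha₁ ha₂ haH₁ h), hbH₁, haH₂, hb2H₂,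
    fun h => ha12 (hone hH₂ ha₁ ha₂ h haH₂), hbH₂⟩

theorem sum_inter_symm {S T : ι → Finset α} {i : ι} {t : Finset ι}
    (hsum : ∀ X, (S i ∩ X).card + ∑ j ∈ t, (S j ∩ X).card =
      (T i ∩ X).card + ∑ j ∈ t, (T j ∩ X).card) (X : Finset α) :
    (T i ∩ X).card + ∑ j ∈ t, (T j ∩ X).card = (S i ∩ X).card + ∑ j ∈ t, (S j ∩ X).card :=
  (hsum X).symm

variable [DecidableEq ι]

/-- The detour around two tight hyperplanes: both `S` and `T` move towards a common element `z` of
these hyperplanes. -/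
theorem exists_conn_of_tight_pair {S T : ι → Finset α} {i : ι} {t : Finset ι} (hi : i ∉ t)
    (hS : ∀ k, P.Base (S k)) (hT : ∀ k, P.Base (T k))
    (hsum : ∀ X, (S i ∩ X).card + ∑ j ∈ t, (S j ∩ X).card =
      (T i ∩ X).card + ∑ j ∈ t, (T j ∩ X).card)
    {a₁ a₂ b₁ b₂ z : α} {H₁ H₂ K : Finset α} (hD : S i \ T i = {a₁, a₂})
    (hD' : T i \ S i = {b₁, b₂}) (ha12 : a₁ ≠ a₂)
    (hH₁ : P.Tight t S H₁) (hH₂ : P.Tight t S H₂) (ha₁ : a₁ ∈ H₁) (ha₁' : a₁ ∉ H₂)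
    (ha₂ : a₂ ∈ H₂) (hb₂ : b₂ ∈ H₂) (hb₁ : b₁ ∉ H₂) (hK : K ∈ P.hyp)
    (hsK : insert b₁ ((S i).erase a₁) ⊆ K) (hz₁ : z ∈ H₁) (hz₂ : z ∈ H₂) (hzS : z ∉ S i)
    (hzT : z ∉ T i) (hzK : z ∉ K) :
    ∃ S' T', P.Conn S S' ∧ (∀ k, k ≠ i → k ∉ t → S' k = S k) ∧ P.Conn T T' ∧
      (∀ k, k ≠ i → k ∉ t → T' k = T k) ∧ (S' i \ T' i).card < (S i \ T i).card := by
  have mD : ∀ x, x ∈ S i ∧ x ∉ T i ↔ x = a₁ ∨ x = a₂ := fun x => by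
    rw [← Finset.mem_sdiff, hD, Finset.mem_insert, Finset.mem_singleton]
  have mD' : ∀ x, x ∈ T i ∧ x ∉ S i ↔ x = b₁ ∨ x = b₂ := fun x => by
    rw [← Finset.mem_sdiff, hD', Finset.mem_insert, Finset.mem_singleton]
  have sa₁ := (mD a₁).2 (.inl rfl)
  have sa₂ := (mD a₂).2 (.inr rfl)
  have tb₁ := (mD' b₁).2 (.inl rfl)
  have tb₂ := (mD' b₂).2 (.inr rfl)
  have hat : ∃ l ∈ t, a₁ ∉ S l := exists_notMem_of_sum_inter hsum sa₁.1 sa₁.2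
  have hbt : ∃ l ∈ t, b₂ ∉ T l :=
    exists_notMem_of_sum_inter (sum_inter_symm hsum) tb₂.1 tb₂.2
  obtain ⟨l, hl, -⟩ := id hat
  have hne : H₁ ≠ H₂ := fun h => ha₁' (h ▸ ha₁)
  have hzSt : ∃ j ∈ t, z ∈ S j := ⟨l, hl,
    ((hH₁.card_inter_add_two hS ⟨l, hl⟩ hH₂ hne).2 l hl).2 (Finset.mem_inter.2 ⟨hz₁, hz₂⟩)⟩
  have hzTt : ∃ j ∈ t, z ∈ T j := by
    by_contra! h
    have h1 := hsum {z}
    rw [Finset.inter_singleton_of_notMem hzS, Finset.inter_singleton_of_notMem hzT,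
      Finset.sum_eq_zero (s := t) (f := fun j => (T j ∩ {z}).card) fun j hj => by
        rw [Finset.inter_singleton_of_notMem (h j hj)]; rfl] at h1
    obtain ⟨j, hj, hzj⟩ := hzSt
    have h2 := Finset.single_le_sum (f := fun j => (S j ∩ {z}).card) (fun _ _ => Nat.zero_le _) hj
    simp only [Finset.inter_singleton_of_mem hzj, Finset.card_singleton, Finset.card_empty] at h1 h2
    omega
  have hH₂T : P.Tight t T H₂ := by
    refine tight_of_sum_le hH₂ hT ?_
    have h1 := card_sdiff_inter_add (S i) (T i) H₂
    have h2 := card_sdiff_inter_add (T i) (S i) H₂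
    rw [hD, Finset.insert_inter_of_notMem ha₁', Finset.singleton_inter_of_mem ha₂,
      Finset.card_singleton] at h1
    rw [hD', Finset.insert_inter_of_notMem hb₁, Finset.singleton_inter_of_mem hb₂,
      Finset.card_singleton, Finset.inter_comm (T i)] at h2
    have := hsum H₂
    omega
  have hTK : (T i).erase b₂ ⊆ K := fun x hx => hsK <| by
    rw [Finset.mem_erase] at hx
    rw [Finset.mem_insert, Finset.mem_erase]
    by_cases h : x ∈ S i
    · exact Or.inr ⟨fun h => sa₁.2 (h ▸ hx.2), h⟩
    · exact Or.inl (((mD' x).1 ⟨hx.2, h⟩).resolve_right hx.1)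
  obtain ⟨S', hS', hSk, hSi⟩ := exists_conn_swap hS hi sa₁.1 hzS
    (Base.swap_of_notMem (hS i).1 sa₁.1 hK ((Finset.subset_insert _ _).trans hsK) hzS hzK) hzSt hat
    fun H hH haH => hH₁.eq_of_mem hS hH ha₁ haH hat ▸ hz₁
  obtain ⟨T', hT', hTk, hTi⟩ := exists_conn_swap hT hi tb₂.1 hzT
    (Base.swap_of_notMem (hT i).1 tb₂.1 hK hTK hzT hzK) hzTt hbt
    fun H hH hbH => hH₂T.eq_of_mem hT hH hb₂ hbH hbt ▸ hz₂
  refine ⟨S', T', hS', hSk, hT', hTk, ?_⟩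
  have h1 : S' i \ T' i ⊆ {a₂} := by
    intro x hx
    rw [hSi, hTi, Finset.mem_sdiff, Finset.mem_insert, Finset.mem_insert, Finset.mem_erase,
      Finset.mem_erase] at hx
    rw [Finset.mem_singleton]
    obtain ⟨hxa, hxS⟩ := hx.1.resolve_left fun h => hx.2 (.inl h)
    have hxT : x ∉ T i := fun h => hx.2 (.inr ⟨fun e => tb₂.2 (e ▸ hxS), h⟩)
    exact ((mD x).1 ⟨hxS, hxT⟩).resolve_left hxa
  have h3 := Finset.card_le_card h1
  rw [hD, Finset.card_pair ha12]
  rw [Finset.card_singleton] at h3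
  omega

theorem exists_conn_closer {S T : ι → Finset α} {i : ι} {t : Finset ι} (hi : i ∉ t)
    (hS : ∀ k, P.Base (S k)) (hT : ∀ k, P.Base (T k))
    (hsum : ∀ X, (S i ∩ X).card + ∑ j ∈ t, (S j ∩ X).card =
      (T i ∩ X).card + ∑ j ∈ t, (T j ∩ X).card) (hne : S i ≠ T i) :
    ∃ S' T', P.Conn S S' ∧ (∀ k, k ≠ i → k ∉ t → S' k = S k) ∧ P.Conn T T' ∧
      (∀ k, k ≠ i → k ∉ t → T' k = T k) ∧ (S' i \ T' i).card < (S i \ T i).card := by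
  by_cases hgood : ∃ a ∈ S i \ T i, ∃ b ∈ T i \ S i, P.Base (insert b ((S i).erase a)) ∧
      ∀ H, P.Tight t S H → a ∈ H → b ∈ H
  · obtain ⟨a, ha, b, hb, hB, htight⟩ := hgood
    have ha' := Finset.mem_sdiff.1 ha
    have hb' := Finset.mem_sdiff.1 hb
    obtain ⟨S', hS', hSk, hSi⟩ := exists_conn_swap hS hi ha'.1 hb'.2 hB
      (exists_mem_of_sum_inter hsum hb'.1 hb'.2) (exists_notMem_of_sum_inter hsum ha'.1 ha'.2)
      htight
    refine ⟨S', T, hS', hSk, .refl, fun _ _ _ => rfl, Finset.card_lt_card ?_⟩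
    rw [Finset.ssubset_iff_of_subset]
    · exact ⟨a, ha, fun h => by
        rw [hSi, Finset.mem_sdiff, Finset.mem_insert, Finset.mem_erase] at h
        rcases h.1 with h1 | h1
        · exact ha'.2 (h1 ▸ hb'.1)
        · exact h1.1 rfl⟩
    · intro x hx
      rw [hSi, Finset.mem_sdiff, Finset.mem_insert, Finset.mem_erase] at hx
      rcases hx.1 with h1 | h1
      · exact absurd (h1 ▸ hb'.1) hx.2
      · exact Finset.mem_sdiff.2 ⟨h1.2, hx.2⟩
  push Not at hgood
  obtain ⟨a₁, a₂, b₁, b₂, H₁, H₂, hD, hD', ha12, hn1, hn2, hH₁, hH₂, ha₁, hb₁, ha₂', hb₂',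
    ha₂, hb₂, ha₁', hb₁'⟩ := exists_tight_pair_of_no_swap hS hT hsum hne
      fun a ha b hb hB => hgood a ha b hb hB
  have sa₁ := Finset.mem_sdiff.1 (show a₁ ∈ S i \ T i by simp [hD])
  have sa₂ := Finset.mem_sdiff.1 (show a₂ ∈ S i \ T i by simp [hD])
  have tb₁ := Finset.mem_sdiff.1 (show b₁ ∈ T i \ S i by simp [hD'])
  have tb₂ := Finset.mem_sdiff.1 (show b₂ ∈ T i \ S i by simp [hD'])
  obtain ⟨K₁, hK₁, hs₁⟩ := (hS i).exists_hyp_of_not_base_swap sa₁.1 tb₁.2 hn1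
  obtain ⟨K₂, hK₂, hs₂⟩ := (hS i).exists_hyp_of_not_base_swap sa₂.1 tb₂.2 hn2
  obtain ⟨l, hl, -⟩ := exists_notMem_of_sum_inter hsum sa₁.1 sa₁.2
  have hHne : H₁ ≠ H₂ := fun h => ha₁' (h ▸ ha₁)
  have hZ := (hH₁.card_inter_add_two hS ⟨l, hl⟩ hH₂ hHne).1
  have hXcard : (((S i).erase a₁).erase a₂).card + 2 = P.rank := by
    have h1 := (hS i).card_erase_add_one sa₁.1
    have h2 := Finset.card_erase_add_one (show a₂ ∈ (S i).erase a₁ by simp [sa₂.1, ha12.symm])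
    omega
  have hzT : ∀ {z}, z ∈ H₁ → z ∈ H₂ → z ∉ S i → z ∉ T i := fun {z} h1 h2 hzS hzT => by
    have : z ∈ T i \ S i := Finset.mem_sdiff.2 ⟨hzT, hzS⟩
    rw [hD', Finset.mem_insert, Finset.mem_singleton] at this
    rcases this with rfl | rfl
    · exact hb₁' h2
    · exact hb₂' h1
  obtain ⟨z, hz₁, hz₂, hzS, hzK⟩ : ∃ z, z ∈ H₁ ∧ z ∈ H₂ ∧ z ∉ S i ∧ (z ∉ K₁ ∨ z ∉ K₂) := by
    by_contra! hall
    have hKne : K₁ ≠ K₂ := by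
      rintro rfl
      refine (hS i).2 K₁ hK₁ fun x hx => ?_
      by_cases h : x = a₁
      · subst h
        exact hs₂ (by simp [hx, ha12])
      · exact hs₁ (by simp [hx, h])
    have hXK : ((S i).erase a₁).erase a₂ ⊆ K₁ ∩ K₂ := by
      intro x hx
      simp only [Finset.mem_erase] at hx
      exact Finset.mem_inter.2 ⟨hs₁ (by simp [hx]), hs₂ (by simp [hx])⟩
    have hZX : H₁ ∩ H₂ ⊆ ((S i).erase a₁).erase a₂ := by
      intro z hz
      rw [Finset.mem_inter] at hz
      by_contra hzX
      have hzS : z ∉ S i := fun h => hzX <| by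
        simp only [Finset.mem_erase]
        exact ⟨fun e => ha₂' (e ▸ hz.1), fun e => ha₁' (e ▸ hz.2), h⟩
      have h := hall z hz.1 hz.2 hzS
      refine hKne (P.eq_of_subset K₁ hK₁ K₂ hK₂ (insert z (((S i).erase a₁).erase a₂)) ?_ ?_ ?_)
      · exact Finset.insert_subset h.1 (hXK.trans Finset.inter_subset_left)
      · exact Finset.insert_subset h.2 (hXK.trans Finset.inter_subset_right)
      · rw [Finset.card_insert_of_notMem hzX]
        omega
    have hEq : H₁ ∩ H₂ = ((S i).erase a₁).erase a₂ :=
      Finset.eq_of_subset_of_card_le hZX (by omega)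
    have hK : K₁ = H₂ := by
      refine P.eq_of_subset K₁ hK₁ H₂ hH₂.1 ((S i).erase a₁)
        ((Finset.subset_insert _ _).trans hs₁) (fun x hx => ?_) ((hS i).card_erase_add_one sa₁.1)
      by_cases h : x = a₂
      · exact h ▸ ha₂
      · exact Finset.inter_subset_right (hEq ▸ Finset.mem_erase.2 ⟨h, hx⟩ : x ∈ H₁ ∩ H₂)
    exact hb₁' (hK ▸ hs₁ (by simp))
  rcases hzK with hzK | hzK
  · exact exists_conn_of_tight_pair hi hS hT hsum hD hD' ha12 hH₁ hH₂ ha₁ ha₁' ha₂ hb₂ hb₁'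
      hK₁ hs₁ hz₁ hz₂ hzS (hzT hz₁ hz₂ hzS) hzK
  · exact exists_conn_of_tight_pair hi hS hT hsum (by rw [hD, Finset.pair_comm])
      (by rw [hD', Finset.pair_comm]) ha12.symm hH₂ hH₁ ha₂ ha₂' ha₁ hb₁ hb₂'
      hK₂ hs₂ hz₂ hz₁ hzS (hzT hz₁ hz₂ hzS) hzK

/-- Two tuples of bases with the same multiset union are connected. -/
theorem conn_of_sum_inter_eq [Fintype ι] (s : Finset ι) : ∀ S T : ι → Finset α,
    (∀ k, P.Base (S k)) → (∀ k, P.Base (T k)) → (∀ k ∉ s, S k = T k) →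
    (∀ X, ∑ k, (S k ∩ X).card = ∑ k, (T k ∩ X).card) → P.Conn S T := by
  induction s using Finset.induction_on with
  | empty =>
    intro S T _ _ h _
    rw [funext fun k => h k (Finset.notMem_empty k)]
    exact .refl
  | insert i t hi ih =>
    intro S T
    induction hm : (S i \ T i).card using Nat.strong_induction_on generalizing S T with
    | _ m ihm =>
    intro hS hT hoff hsum
    by_cases hST : S i = T i
    · refine ih S T hS hT (fun k hk => ?_) hsum
      by_cases hki : k = i
      · exact hki ▸ hST
      · exact hoff k (by simp [hki, hk])
    have hsum' : ∀ X, (S i ∩ X).card + ∑ j ∈ t, (S j ∩ X).card =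
        (T i ∩ X).card + ∑ j ∈ t, (T j ∩ X).card := fun X => by
      have h1 := hsum X
      rw [← Finset.sum_add_sum_compl (insert i t), ← Finset.sum_add_sum_compl (insert i t) fun k =>
        (T k ∩ X).card, Finset.sum_insert hi, Finset.sum_insert hi] at h1
      have h2 : ∑ k ∈ (insert i t)ᶜ, (S k ∩ X).card = ∑ k ∈ (insert i t)ᶜ, (T k ∩ X).card :=
        Finset.sum_congr rfl fun k hk => by rw [hoff k (Finset.mem_compl.1 hk)]
      omega
    obtain ⟨S', T', hS', hSk, hT', hTk, hlt⟩ := exists_conn_closer hi hS hT hsum' hST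
    refine hS'.trans (Conn.trans ?_ hT'.symm)
    refine ihm _ (hm ▸ hlt) S' T' rfl (hS'.base hS) (hT'.base hT) (fun k hk => ?_) fun X => ?_
    · have h := hk
      rw [Finset.mem_insert, not_or] at h
      rw [hSk k h.1 h.2, hTk k h.1 h.2, hoff k hk]
    · rw [hS'.sum_inter, hT'.sum_inter, hsum]

end PavingSystem

namespace Matroid

variable {α : Type u} {M : Matroid α}

theorem IsPaving.indep_of_encard_lt (hM : M.IsPaving) {X : Set α} (hX : X ⊆ M.E)
    (h : X.encard < M.eRank) : M.Indep X := by
  by_contra hi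
  obtain ⟨C, hC, hCc⟩ := ((not_indep_iff hX).1 hi).exists_isCircuit_subset
  have h1 := (Set.encard_le_encard hC).trans_lt h
  rcases hM C hCc with h2 | h2
  · exact absurd h1 (by rw [h2]; exact lt_irrefl _)
  · rw [h2] at h1
    exact absurd (le_self_add.trans_lt h1) (lt_irrefl _)

theorem IsFlat.closure_eq_of_eRk_le [M.Finite] {Y F : Set α} (hF : M.IsFlat F) (hYF : Y ⊆ F)
    (h : M.eRk F ≤ M.eRk Y) : M.closure Y = F := by
  rw [(M.isRkFinite_set Y).closure_eq_closure_of_subset_of_eRk_ge_eRk hYF h, hF.closure]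

theorem coe_toNat_eRank (M : Matroid α) [M.Finite] : (M.eRank.toNat : ℕ∞) = M.eRank := by
  refine ENat.natCast_toNat ?_
  rw [← eRk_ground]
  exact (M.isRkFinite_set M.E).eRk_lt_top.ne

theorem coe_encard_add_one_eq [M.Finite] {Y : Finset α} (h : Y.card + 1 = M.eRank.toNat) :
    (Y : Set α).encard + 1 = M.eRank := by
  rw [Set.encard_coe_eq_coe_finsetCard, ← coe_toNat_eRank, ← h]
  rfl

/-- The hyperplanes of a paving matroid form a paving system. -/
noncomputable def IsPaving.system [M.Finite] (hM : M.IsPaving) : PavingSystem α where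
  rank := M.eRank.toNat
  hyp := {H | M.IsFlat (H : Set α) ∧ M.eRk (H : Set α) + 1 = M.eRank}
  eq_of_subset := by
    rintro H ⟨hH, hr⟩ H' ⟨hH', hr'⟩ Y hY hY' hc
    have hc' := coe_encard_add_one_eq hc
    have hYi : M.Indep (Y : Set α) := by
      refine hM.indep_of_encard_lt ((Finset.coe_subset.2 hY).trans hH.subset_ground) ?_
      rw [← hc', Set.encard_coe_eq_coe_finsetCard]
      exact_mod_cast Nat.lt_succ_self _
    have key : ∀ {F : Finset α}, M.IsFlat (F : Set α) → M.eRk (F : Set α) + 1 = M.eRank →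
        Y ⊆ F → M.closure Y = F := fun {F} hF hr hYF => by
      refine hF.closure_eq_of_eRk_le (Finset.coe_subset.2 hYF) ?_
      rw [← hc', ← hYi.eRk_eq_encard] at hr
      exact (ENat.add_le_add_iff_right ENat.one_ne_top).1 hr.le
    exact Finset.coe_injective ((key hH hr hY).symm.trans (key hH' hr' hY'))

theorem IsPaving.base_iff [M.Finite] (hM : M.IsPaving) {X : Finset α} (hX : (X : Set α) ⊆ M.E) :
    hM.system.Base X ↔ M.IsBase (X : Set α) := by
  classical
  constructor
  · rintro ⟨hc, hH⟩
    have hc' : (X : Set α).encard = M.eRank := by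
      rw [Set.encard_coe_eq_coe_finsetCard, ← coe_toNat_eRank, hc]
      rfl
    by_contra hB
    have hXi : ¬ M.Indep (X : Set α) := fun hi => by
      obtain ⟨B, hB', hXB⟩ := hi.exists_isBase_superset
      refine hB ((X.finite_toSet.eq_of_subset_of_encard_le hXB ?_).symm ▸ hB')
      rw [hc', hB'.encard_eq_eRank]
    have hlt := eRk_lt_encard_of_dep_of_finite X.finite_toSet ((not_indep_iff hX).1 hXi)
    have hne : X.Nonempty := by
      rw [Finset.nonempty_iff_ne_empty]
      rintro rfl
      simp at hXi
    obtain ⟨x, hx⟩ := hne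
    have hYc : (X.erase x).card + 1 = M.eRank.toNat := by
      rw [Finset.card_erase_add_one hx, hc]
      rfl
    have hYc' := coe_encard_add_one_eq hYc
    have hYX : ((X.erase x : Finset α) : Set α) ⊆ X := Finset.coe_subset.2 (Finset.erase_subset _ _)
    have hYi : M.Indep ((X.erase x : Finset α) : Set α) := by
      refine hM.indep_of_encard_lt (hYX.trans hX) ?_
      rw [← hYc', Set.encard_coe_eq_coe_finsetCard]
      exact_mod_cast Nat.lt_succ_self _
    have hrk : M.eRk (X : Set α) + 1 = M.eRank := by
      refine le_antisymm ?_ ?_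
      · rw [← hc']
        exact Order.add_one_le_of_lt hlt
      · rw [← hYc', ← hYi.eRk_eq_encard]
        gcongr
        exact M.eRk_mono hYX
    have hfin : (M.closure X).Finite := M.ground_finite.subset (M.closure_subset_ground _)
    refine hH hfin.toFinset ⟨?_, ?_⟩ ?_
    · rw [Set.Finite.coe_toFinset]
      exact M.isFlat_closure _
    · rw [Set.Finite.coe_toFinset, eRk_closure_eq, hrk]
    · rw [← Finset.coe_subset, Set.Finite.coe_toFinset]
      exact M.subset_closure _ hX
  · intro hB
    refine ⟨?_, fun H hH hs => ?_⟩
    · have := hB.encard_eq_eRank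
      rw [Set.encard_coe_eq_coe_finsetCard, ← coe_toNat_eRank] at this
      exact_mod_cast this
    · have h1 := M.eRk_mono (Finset.coe_subset.2 hs)
      rw [hB.eRk_eq_eRank, ← hH.2] at h1
      have h2 : M.eRk (H : Set α) ≠ ⊤ := (M.isRkFinite_set _).eRk_lt_top.ne
      exact absurd h1 (not_le.2 (ENat.lt_add_one_iff h2 |>.2 le_rfl))

/-- A basis of a finite matroid as a finite set. -/
noncomputable def BaseOf.toFinset [M.Finite] (B : M.BaseOf) : Finset α :=
  (M.ground_finite.subset B.2.subset_ground).toFinset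

theorem BaseOf.coe_toFinset [M.Finite] (B : M.BaseOf) : (B.toFinset : Set α) = B.1 :=
  Set.Finite.coe_toFinset _

theorem BaseOf.mem_toFinset [M.Finite] (B : M.BaseOf) {e : α} : e ∈ B.toFinset ↔ e ∈ B.1 :=
  Set.Finite.mem_toFinset _

theorem BaseOf.toFinset_injective [M.Finite] :
    Function.Injective (BaseOf.toFinset : M.BaseOf → Finset α) := fun B B' h =>
  Subtype.ext (by rw [← B.coe_toFinset, h, B'.coe_toFinset])

theorem IsPaving.base_toFinset [M.Finite] (hM : M.IsPaving) (B : M.BaseOf) :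
    hM.system.Base B.toFinset := by
  rw [hM.base_iff (by rw [B.coe_toFinset]; exact B.2.subset_ground), B.coe_toFinset]
  exact B.2

theorem coe_insert_erase [DecidableEq α] {A : Finset α} {a b : α} (hab : a ≠ b) :
    ((insert b (A.erase a) : Finset α) : Set α) = ((A : Set α) ∪ {b}) \ {a} := by
  rw [Finset.coe_insert, Finset.coe_erase, Set.union_singleton,
    Set.insert_sdiff_of_notMem _ (by simpa using hab.symm)]

theorem IsPaving.exists_exchangeStep [M.Finite] [DecidableEq α] (hM : M.IsPaving) {n : ℕ}
    {S : Fin n → M.BaseOf} {V : Fin n → Finset α}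
    (h : hM.system.Step (fun k => (S k).toFinset) V) :
    ∃ T : Fin n → M.BaseOf, (fun k => (T k).toFinset) = V ∧ M.ExchangeStep S T := by
  obtain ⟨-, hV, i, j, hij, ⟨a, ha, haj, b, hb, hbi, hVi, hVj⟩, hk⟩ := h
  have hab : a ≠ b := fun h => haj (h ▸ hb)
  have hsub : ∀ k, (((S k).toFinset : Finset α) : Set α) ⊆ M.E := fun k => by
    rw [(S k).coe_toFinset]
    exact (S k).2.subset_ground
  have hVE : ∀ k, (V k : Set α) ⊆ M.E := by
    intro k
    by_cases hki : k = i
    · rw [hki, hVi, coe_insert_erase hab]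
      exact Set.sdiff_subset.trans (Set.union_subset (hsub i) (by simpa using hsub j hb))
    by_cases hkj : k = j
    · rw [hkj, hVj, coe_insert_erase hab.symm]
      exact Set.sdiff_subset.trans (Set.union_subset (hsub j) (by simpa using hsub i ha))
    · rw [hk k hki hkj]
      exact hsub k
  refine ⟨fun k => ⟨V k, (hM.base_iff (hVE k)).1 (hV k)⟩, funext fun k => ?_, i, j, hij,
    ⟨a, ⟨(BaseOf.mem_toFinset _).1 ha, fun h => haj ((BaseOf.mem_toFinset _).2 h)⟩, b,
      ⟨(BaseOf.mem_toFinset _).1 hb, fun h => hbi ((BaseOf.mem_toFinset _).2 h)⟩, ?_, ?_⟩,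
    fun k h1 h2 => Subtype.ext ?_⟩
  · exact Finset.coe_injective (BaseOf.coe_toFinset _)
  · simp only [hVi, coe_insert_erase hab, BaseOf.coe_toFinset]
  · simp only [hVj, coe_insert_erase hab.symm, BaseOf.coe_toFinset]
  · simp only [hk k h1 h2, BaseOf.coe_toFinset]

theorem sum_card_inter_eq [M.Finite] [DecidableEq α] {n : ℕ} (S : Fin n → M.BaseOf)
    (X : Finset α) :
    ∑ k, ((S k).toFinset ∩ X).card = ∑ e ∈ X, M.multisetUnion S e := by
  have h1 : ∀ k, ((S k).toFinset ∩ X).card = ∑ e ∈ X, if e ∈ (S k).toFinset then 1 else 0 :=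
    fun k => by rw [Finset.inter_comm, ← Finset.filter_mem_eq_inter, Finset.card_filter]
  simp only [h1]
  rw [Finset.sum_comm]
  refine Finset.sum_congr rfl fun e _ => ?_
  rw [← Finset.card_filter, multisetUnion, ← Set.ncard_coe_finset]
  simp [BaseOf.mem_toFinset]

theorem IsPaving.whiteInDegree [M.Finite] (hM : M.IsPaving) (n : ℕ) : M.WhiteInDegree n := by
  classical
  intro S T hST
  have hconn : hM.system.Conn (fun k => (S k).toFinset) (fun k => (T k).toFinset) :=
    PavingSystem.conn_of_sum_inter_eq Finset.univ _ _ (fun k => hM.base_toFinset _)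
      (fun k => hM.base_toFinset _) (fun k hk => absurd (Finset.mem_univ k) hk)
      fun X => by rw [sum_card_inter_eq, sum_card_inter_eq, hST]
  have key : ∀ V, hM.system.Conn (fun k => (S k).toFinset) V →
      ∃ U : Fin n → M.BaseOf, (fun k => (U k).toFinset) = V ∧
        Relation.ReflTransGen M.ExchangeStep S U := by
    intro V hV
    induction hV with
    | refl => exact ⟨S, rfl, .refl⟩
    | tail _ hstep ih =>
      obtain ⟨U, rfl, hU⟩ := ih
      obtain ⟨W, hW, hUW⟩ := hM.exists_exchangeStep hstep
      exact ⟨W, hW, hU.tail hUW⟩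
  obtain ⟨U, hU, hSU⟩ := key _ hconn
  have : U = T := funext fun k => BaseOf.toFinset_injective (congrFun hU k)
  exact this ▸ hSU

end Matroid

namespace Matroid

variable {α : Type u} {M : Matroid α}

open MvPolynomial

/-- The exponent vector of the squarefree monomial of a basis. -/
noncomputable def BaseOf.exponent [M.Finite] (B : M.BaseOf) : M.E →₀ ℕ :=
  haveI : Finite M.E := M.ground_finite.to_subtype
  Finsupp.equivFunOnFinite.symm (Set.indicator {e : M.E | (e : α) ∈ B.1} 1)

theorem BaseOf.exponent_apply [M.Finite] (B : M.BaseOf) (e : M.E) [Decidable ((e : α) ∈ B.1)] :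
    B.exponent e = if (e : α) ∈ B.1 then 1 else 0 := by
  simp [BaseOf.exponent, Set.indicator_apply]

theorem toricMap_X [M.Finite] (K : Type v) [Field K] (B : M.BaseOf) :
    M.toricMap K (X B) = monomial B.exponent 1 := by
  classical
  have : Fintype M.E := M.ground_finite.fintype
  rw [toricMap, aeval_X, finprod_eq_prod_of_fintype, monomial_eq, map_one, one_mul,
    Finsupp.prod_fintype _ _ (fun _ => pow_zero _)]
  refine Finset.prod_congr rfl fun e _ => ?_
  rw [B.exponent_apply, finprod_eq_if]
  split_ifs with h <;> simp

/-- The map on exponents that underlies the toric map. -/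
noncomputable def toricExponent (M : Matroid α) [M.Finite] :
    (M.BaseOf →₀ ℕ) →ₗ[ℕ] (M.E →₀ ℕ) :=
  Finsupp.linearCombination ℕ BaseOf.exponent

theorem toricMap_monomial [M.Finite] (K : Type v) [Field K] (u : M.BaseOf →₀ ℕ) :
    M.toricMap K (monomial u 1) = monomial (M.toricExponent u) 1 := by
  rw [monomial_eq, map_one, one_mul, map_finsuppProd, toricExponent,
    Finsupp.linearCombination_apply, monomial_finsupp_sum_index, map_one, one_mul]
  refine Finsupp.prod_congr fun B _ => ?_
  rw [map_pow, toricMap_X, monomial_pow, one_pow]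

theorem exponent_add_eq [M.Finite] {A B A' B' : M.BaseOf} (h : M.IsSymmExchange A B A' B') :
    A.exponent + B.exponent = A'.exponent + B'.exponent := by
  classical
  obtain ⟨a, ⟨ha, haB⟩, b, ⟨hb, hbA⟩, hA', hB'⟩ := h
  have hab : a ≠ b := fun h => haB (h ▸ hb)
  ext e
  simp only [Finsupp.add_apply, BaseOf.exponent_apply, hA', hB', Set.mem_sdiff, Set.mem_union,
    Set.mem_singleton_iff]
  by_cases h1 : (e : α) = a
  · simp [h1, ha, haB, hab]
  by_cases h2 : (e : α) = b
  · simp [h2, hb, hbA, hab.symm]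
  · simp [h1, h2]

theorem exchangeBinomials_subset_toricIdeal [M.Finite] (K : Type v) [Field K] :
    M.exchangeBinomials K ⊆ M.toricIdeal K := by
  rintro p ⟨A, B, A', B', h, rfl⟩
  rw [SetLike.mem_coe, toricIdeal, RingHom.mem_ker, map_sub, map_mul, map_mul, toricMap_X,
    toricMap_X, toricMap_X, toricMap_X, monomial_mul, monomial_mul, exponent_add_eq h, sub_self]

theorem _root_.Finsupp.exists_eq_sum_single {β : Type*} (u : β →₀ ℕ) :
    ∃ (n : ℕ) (S : Fin n → β), u = ∑ i, Finsupp.single (S i) 1 := by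
  induction u using Finsupp.induction_linear with
  | zero => exact ⟨0, Fin.elim0, by simp⟩
  | add u v hu hv =>
    obtain ⟨n, S, rfl⟩ := hu
    obtain ⟨m, T, rfl⟩ := hv
    exact ⟨n + m, Fin.append S T, by simp [Fin.sum_univ_add]⟩
  | single a n => exact ⟨n, fun _ => a, by simp⟩

theorem toricExponent_sum_single_apply [M.Finite] {n : ℕ} (S : Fin n → M.BaseOf) (e : M.E) :
    M.toricExponent (∑ i, Finsupp.single (S i) 1) e = M.multisetUnion S e := by
  classical
  simp only [map_sum, toricExponent, Finsupp.linearCombination_single, one_smul,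
    Finsupp.finsetSum_apply, BaseOf.exponent_apply]
  rw [← Finset.card_filter, multisetUnion, ← Set.ncard_coe_finset]
  simp

theorem multisetUnion_eq_zero {n : ℕ} (S : Fin n → M.BaseOf) {e : α} (he : e ∉ M.E) :
    M.multisetUnion S e = 0 := by
  have : {i : Fin n | e ∈ (S i).1} = ∅ :=
    Set.eq_empty_of_forall_notMem fun i hi => he ((S i).2.subset_ground hi)
  rw [multisetUnion, this, Set.ncard_empty]

theorem sum_multisetUnion [M.Finite] {n : ℕ} (S : Fin n → M.BaseOf) :
    ∑ e ∈ M.ground_finite.toFinset, M.multisetUnion S e = n * M.eRank.toNat := by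
  classical
  rw [← sum_card_inter_eq]
  have h : ∀ k, ((S k).toFinset ∩ M.ground_finite.toFinset).card = M.eRank.toNat := fun k => by
    rw [Finset.inter_eq_left.2, ← (S k).2.encard_eq_eRank, ← (S k).coe_toFinset,
      Set.encard_coe_eq_coe_finsetCard]
    · rfl
    · intro e he
      rw [Set.Finite.mem_toFinset]
      exact (S k).2.subset_ground ((S k).mem_toFinset.1 he)
  simp [h]

theorem mk_prod_eq_of_exchangeStep (K : Type v) [Field K] {n : ℕ} {S T : Fin n → M.BaseOf}
    (h : M.ExchangeStep S T) :
    Ideal.Quotient.mk (Ideal.span (M.exchangeBinomials K)) (∏ i, X (S i)) =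
      Ideal.Quotient.mk _ (∏ i, X (T i)) := by
  obtain ⟨i, j, hij, hex, hk⟩ := h
  rw [map_prod, map_prod]
  refine Finset.prod_eq_of_pair (Finset.mem_univ i) (Finset.mem_univ j) hij ?_
    fun k h1 h2 => by rw [hk k h1 h2]
  rw [← map_mul, ← map_mul, Ideal.Quotient.eq]
  exact Ideal.subset_span ⟨_, _, _, _, hex, rfl⟩

theorem mk_monomial_eq [M.Finite] (hM : ∀ n, M.WhiteInDegree n) (hr : 1 ≤ M.eRank) (K : Type v)
    [Field K] {u v : M.BaseOf →₀ ℕ} (h : M.toricExponent u = M.toricExponent v) :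
    Ideal.Quotient.mk (Ideal.span (M.exchangeBinomials K)) (monomial u 1) =
      Ideal.Quotient.mk _ (monomial v 1) := by
  obtain ⟨n, S, rfl⟩ := u.exists_eq_sum_single
  obtain ⟨m, T, rfl⟩ := v.exists_eq_sum_single
  have hST : M.multisetUnion S = M.multisetUnion T := by
    funext e
    by_cases he : e ∈ M.E
    · have := DFunLike.congr_fun h ⟨e, he⟩
      rwa [toricExponent_sum_single_apply, toricExponent_sum_single_apply] at this
    · rw [multisetUnion_eq_zero S he, multisetUnion_eq_zero T he]
  have hnm : n = m := by
    have h1 := sum_multisetUnion S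
    rw [hST, sum_multisetUnion T] at h1
    refine (Nat.eq_of_mul_eq_mul_right (Nat.pos_of_ne_zero fun h0 => ?_) h1).symm
    rw [← coe_toNat_eRank, h0] at hr
    simp at hr
  subst hnm
  have hprod : ∀ S : Fin n → M.BaseOf,
      (monomial (∑ i, Finsupp.single (S i) 1) 1 : MvPolynomial M.BaseOf K) = ∏ i, X (S i) :=
    fun S => monomial_sum_one _ _
  rw [hprod, hprod]
  have hconn := hM n S T hST
  clear h hST
  induction hconn with
  | refl => rfl
  | tail _ hstep ih => rw [ih, mk_prod_eq_of_exchangeStep K hstep]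

/-- White's conjecture in all degrees implies that the exchange binomials generate the toric
ideal. -/
theorem toricIdeal_eq_span [M.Finite] (hM : ∀ n, M.WhiteInDegree n) (hr : 1 ≤ M.eRank) (K : Type v)
    [Field K] : M.toricIdeal K = Ideal.span (M.exchangeBinomials K) := by
  refine le_antisymm (fun p hp => ?_) (Ideal.span_le.2 (exchangeBinomials_subset_toricIdeal K))
  let σ : MvPolynomial M.E K →ₗ[K]
      MvPolynomial M.BaseOf K ⧸ Ideal.span (M.exchangeBinomials K) :=
    (basisMonomials M.E K).constr K fun w =>
      Ideal.Quotient.mk _ (monomial (Function.invFun M.toricExponent w) 1)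
  have hσ : σ ∘ₗ (M.toricMap K).toLinearMap =
      (Ideal.Quotient.mkₐ K (Ideal.span (M.exchangeBinomials K))).toLinearMap := by
    refine (basisMonomials M.BaseOf K).ext fun u => ?_
    have h1 : σ (monomial (M.toricExponent u) 1) =
        Ideal.Quotient.mk _ (monomial (Function.invFun M.toricExponent (M.toricExponent u)) 1) := by
      have := (basisMonomials M.E K).constr_basis K (fun w =>
        Ideal.Quotient.mk (Ideal.span (M.exchangeBinomials K))
          (monomial (Function.invFun M.toricExponent w) 1)) (M.toricExponent u)
      rwa [coe_basisMonomials] at this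
    rw [coe_basisMonomials, LinearMap.comp_apply, AlgHom.toLinearMap_apply, toricMap_monomial, h1,
      AlgHom.toLinearMap_apply, Ideal.Quotient.mkₐ_eq_mk]
    exact mk_monomial_eq hM hr K (Function.invFun_eq ⟨u, rfl⟩)
  have h0 := LinearMap.congr_fun hσ p
  have hp' : M.toricMap K p = 0 := hp
  rw [LinearMap.comp_apply, AlgHom.toLinearMap_apply, hp', map_zero, AlgHom.toLinearMap_apply,
    Ideal.Quotient.mkₐ_eq_mk] at h0
  exact Ideal.Quotient.eq_zero_iff_mem.1 h0.symm

end Matroid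

theorem theorem1p3 {α : Type u} (M : Matroid α) [M.Finite] (hM : M.IsPaving) :
    (∀ n : ℕ, M.WhiteInDegree n) ∧
    (1 ≤ M.eRank → ∀ (K : Type v) [Field K],
      M.toricIdeal K = Ideal.span (M.exchangeBinomials K)) := 
  ⟨hM.whiteInDegree, fun hr K _ => Matroid.toricIdeal_eq_span hM.whiteInDegree hr K⟩
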